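/- Let $F\in L^2(\mathbb{R})$ (complex-valued) be not almost everywhere zero, and suppose that for some $y_0\in\mathbb{R}$ one has $F(y)=0$ for almost every $y<y_0$. Let $\varphi=|\mathcal{F}[F]|$ a.e., where $\mathcal{F}$ is the Fourier–Plancherel operator on $L^2(\mathbb{R})$, i.e. the continuous extension of $\mathcal F[f](x)=\int_{\mathbb R} f(y)\,e^{-2\pi i x y}\,dy$. Then: 1. $\displaystyle\int_{\mathbb{R}}\frac{|\log\varphi(x)|}{1+x^2}\,dx<\infty$, where $|\log 0|=\infty$; in particular $\varphi>0$ almost everywhere. 2. Consequently $\varphi$ does not decay exponentially at $+\infty$ or at $-\infty$: for no $B>0$ and $C, X\in\mathbb{R}$ does $\varphi(x)\le C e^{-B|x|}$ hold for almost every $x\ge X$, and for none does it hold for almost every $x\le X$. 3. A decay like $\exp(-B|x|^{\alpha})$ is possible only with $\alpha<1$: if $B>0$ and $\alpha, C, X\in\mathbb{R}$ are such that $\varphi(x)\le C\exp(-B|x|^{\alpha})$ for almost every $x\ge X$, or for almost every $x\le X$, then $\alpha<1$. -/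

import Mathlib

open MeasureTheory Filter
open scoped FourierTransform

/-- `φ` decays at least as fast as `exp (-B |x|^α)` along the filter `l` of the real line, up to a
multiplicative constant and up to a Lebesgue null set: for some `C`, one has
`|φ x| ≤ C exp (-B |x|^α)` for almost every `x` that is far enough along `l`. -/
def DecaysAtLeastLike (φ : ℝ → ℝ) (l : Filter ℝ) (B α : ℝ) : Prop :=
  ∃ C : ℝ, ∀ᶠ x in l ⊓ ae volume, |φ x| ≤ C * Real.exp (-B * |x| ^ α)

/-! Since `F` lives on a right half-line, its Fourier–Laplace transform `h` is holomorphic in the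
lower half-plane, and on the line Im z = -δ its modulus is that of the Fourier transform of `expDamp
F y₀ δ`. Jensen's inequality, carried from the disk by a Cayley map, gives π log|h(a - i - δi)| ≤ ∫
log|h(x - δi)| / (1 + (x - a)²) dx, with the logarithm truncated below
(`pi_mul_log_norm_le_integral`). As log⁺ t ≤ t², Plancherel bounds the positive part by ‖F‖², so the
negative part is bounded uniformly for small δ (`lintegral_posLog_inv_lowerTransform_le`). As δ → 0
the damped functions tend to F in L², hence a subsequence of their transforms converges a.e., and
Fatou's lemma passes the bound to φ (`ae_pos_and_lintegral_posLog_inv_lt_top`). Exponential decay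
would make |log φ| / (1 + x²) at least a multiple of 1/x near infinity, which is not integrable. -/

/-! ### Jensen's inequality on a disk. -/

theorem log_norm_le_circleAverage_log_max {f : ℂ → ℂ} {c : ℂ} {R ε : ℝ} (hR : R ≠ 0)
    (hε : 0 < ε) (hf : AnalyticOnNhd ℂ f (Metric.closedBall c |R|)) (hc : f c ≠ 0) :
    Real.log ‖f c‖ ≤ Real.circleAverage (fun z => Real.log (max ‖f z‖ ε)) c R := by
  have h1 : Real.log ‖f c‖ ≤ Real.circleAverage (fun z => Real.log ‖f z‖) c R := by
    rw [hf.circleAverage_log_norm hR hc, le_add_iff_nonneg_left]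
    refine finsum_nonneg fun u => ?_
    by_cases hu : u ∈ Metric.closedBall c |R|
    · have hdiv : (0 : ℤ) ≤ MeromorphicOn.divisor f (Metric.closedBall c |R|) u :=
        MeromorphicOn.AnalyticOnNhd.divisor_nonneg hf u
      refine mul_nonneg (by exact_mod_cast hdiv) ?_
      by_cases huc : u = c
      · simp [huc]
      have hd : 0 < ‖c - u‖ := norm_pos_iff.2 (sub_ne_zero.2 (Ne.symm huc))
      rw [← Real.log_abs, abs_mul, abs_inv, abs_norm]
      refine Real.log_nonneg ?_
      rw [← div_eq_mul_inv, one_le_div hd, ← dist_eq_norm, dist_comm]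
      exact hu
    · simp [hu]
  have hcon : IsConnected (Metric.closedBall c |R|) :=
    (convex_closedBall c |R|).isConnected ⟨c, by simp⟩
  have hcod := codiscreteWithin_mono Metric.sphere_subset_closedBall
    (hf.preimage_zero_mem_codiscreteWithin hc (by simp) hcon)
  -- At a zero of `f`, `Real.log 0 = 0` may exceed `log ε`, so the pointwise comparison can fail
  -- there; the minimum repairs it on a set invisible to the average.
  have heq : (fun z => Real.log ‖f z‖) =ᶠ[codiscreteWithin (Metric.sphere c |R|)]
      fun z => min (Real.log ‖f z‖) (Real.log (max ‖f z‖ ε)) := by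
    filter_upwards [hcod] with z hz
    exact (min_eq_left (Real.log_le_log (norm_pos_iff.2 hz) (le_max_left _ _))).symm
  have hint := (hf.mono Metric.sphere_subset_closedBall).meromorphicOn.circleIntegrable_log_norm
  rw [Real.circleAverage_congr_codiscreteWithin heq hR] at h1
  refine h1.trans (Real.circleAverage_mono (hint.congr_codiscreteWithin heq) ?_
    fun z _ => min_le_right _ _)
  have h2 : ContinuousOn f (Metric.sphere c |R|) :=
    hf.continuousOn.mono Metric.sphere_subset_closedBall
  exact ContinuousOn.circleIntegrable' <| ContinuousOn.log (h2.norm.sup continuousOn_const)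
    fun z _ => (lt_of_lt_of_le hε (le_max_right _ _)).ne'

/-! ### The Plancherel and integral transforms agree on L¹ ∩ L². -/

/-- Both sides have the same pairing with every test function, because the transform can be moved
onto the test function in either setting. -/
theorem fourier_toLp_ae_eq {G : ℝ → ℂ} (h1 : Integrable G) (h2 : MemLp G 2 volume) :
    (𝓕 (h2.toLp G) : Lp ℂ 2 (volume : Measure ℝ)) =ᵐ[volume] 𝓕 G := by
  refine ae_eq_of_integral_contDiff_smul_eq
    ((Lp.memLp _).locallyIntegrable (by norm_num)) ?_ ?_
  · have : Continuous (𝓕 G) := VectorFourier.fourierIntegral_continuous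
      Real.continuous_fourierChar (by exact continuous_inner) h1
    exact this.locallyIntegrable
  intro g hg hgc
  have hs1 : ContDiff ℝ ((⊤ : ℕ∞) : WithTop ℕ∞) (fun x => (g x : ℂ)) := Complex.ofRealCLM.contDiff.comp hg
  have hs2 : HasCompactSupport (fun x => (g x : ℂ)) := hgc.comp_left (g := Complex.ofReal) rfl
  let γ : SchwartzMap ℝ ℂ := hs2.toSchwartzMap hs1
  have e1 := congrArg (fun T => T γ) (Lp.fourier_toTemperedDistribution_eq (h2.toLp G))
  simp only [Lp.toTemperedDistribution_apply, TemperedDistribution.fourier_apply] at e1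
  have e2 : ∫ x, (𝓕 γ) x • (h2.toLp G : ℝ → ℂ) x = ∫ x, (𝓕 γ) x • G x :=
    integral_congr_ae (by filter_upwards [h2.coeFn_toLp] with x hx; rw [hx])
  have e3 : ∫ x, (𝓕 γ) x • G x = ∫ x, γ x • 𝓕 G x := by
    simpa using! VectorFourier.integral_fourierIntegral_smul_eq_flip (L := innerₗ ℝ)
      Real.continuous_fourierChar continuous_inner γ.integrable h1
  exact e1.symm.trans (e2.trans e3)

/-! ### From the disk to the lower half-plane. -/

/-- The Cayley map from the unit disk to the lower half-plane that sends `0` to `a - I`. -/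
noncomputable def lowerCayley (a : ℝ) (w : ℂ) : ℂ := a - Complex.I * ((1 + w) / (1 - w))

theorem lowerCayley_im (a : ℝ) {w : ℂ} :
    (lowerCayley a w).im = -((1 - ‖w‖ ^ 2) / ‖1 - w‖ ^ 2) := by
  simp only [lowerCayley, Complex.sub_im, Complex.ofReal_im, Complex.mul_im, Complex.I_re,
    Complex.I_im, Complex.div_re, ← Complex.normSq_eq_norm_sq, Complex.normSq_apply,
    Complex.add_re, Complex.sub_re, Complex.one_re, Complex.add_im, Complex.one_im]
  ring

theorem continuousAt_lowerCayley (a : ℝ) {w : ℂ} (hw : w ≠ 1) :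
    ContinuousAt (lowerCayley a) w := by
  have : 1 - w ≠ 0 := sub_ne_zero.2 hw.symm
  unfold lowerCayley
  fun_prop (disch := assumption)

theorem differentiableAt_lowerCayley (a : ℝ) {w : ℂ} (hw : w ≠ 1) :
    DifferentiableAt ℂ (lowerCayley a) w := by
  have : 1 - w ≠ 0 := sub_ne_zero.2 hw.symm
  unfold lowerCayley
  fun_prop (disch := assumption)

theorem lowerCayley_exp (a x : ℝ) :
    lowerCayley a (Complex.exp ((Real.pi - 2 * Real.arctan x : ℝ) * Complex.I)) = a + x := by
  have h0 : (0 : ℝ) < 1 + x ^ 2 := by positivity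
  have hs : Real.sqrt (1 + x ^ 2) ^ 2 = 1 + x ^ 2 := Real.sq_sqrt h0.le
  have hs0 : Real.sqrt (1 + x ^ 2) ≠ 0 := (Real.sqrt_pos.2 h0).ne'
  have hsC : ((Real.sqrt (1 + x ^ 2) : ℝ) : ℂ) ^ 2 = 1 + (x : ℂ) ^ 2 := by exact_mod_cast hs
  have hsC0 : ((Real.sqrt (1 + x ^ 2) : ℝ) : ℂ) ≠ 0 := by exact_mod_cast hs0
  have h1 : Complex.exp (-(Real.arctan x * Complex.I)) =
      (1 - x * Complex.I) / (Real.sqrt (1 + x ^ 2) : ℝ) := by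
    rw [← neg_mul, Complex.exp_mul_I, ← Complex.ofReal_neg, ← Complex.ofReal_cos,
      ← Complex.ofReal_sin, Real.cos_neg, Real.sin_neg, Real.cos_arctan, Real.sin_arctan]
    push_cast
    field_simp
    ring
  have hxI : (1 + x * Complex.I : ℂ) ≠ 0 := fun h => by simpa using congrArg Complex.re h
  have h2 : Complex.exp ((Real.pi - 2 * Real.arctan x : ℝ) * Complex.I) =
      -((1 - x * Complex.I) / (1 + x * Complex.I)) := by
    have : ((Real.pi - 2 * Real.arctan x : ℝ) * Complex.I : ℂ) =
        Real.pi * Complex.I + (-(Real.arctan x * Complex.I) + -(Real.arctan x * Complex.I)) := by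
      push_cast; ring
    rw [this, Complex.exp_add, Complex.exp_add, Complex.exp_pi_mul_I, h1, neg_one_mul, neg_inj,
      div_mul_div_comm, ← pow_two (Complex.ofReal _), hsC, div_eq_div_iff (by rw [← hsC]; positivity) hxI]
    linear_combination (- x ^ 2 * (1 - x * Complex.I)) * Complex.I_sq
  rw [h2, lowerCayley]
  have h3 : 1 - -((1 - x * Complex.I) / (1 + x * Complex.I)) = 2 / (1 + x * Complex.I) := by
    field_simp; ring
  have h4 : 1 + -((1 - x * Complex.I) / (1 + x * Complex.I)) =
      2 * x * Complex.I / (1 + x * Complex.I) := by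
    field_simp; ring
  rw [h3, h4, div_div_div_cancel_right₀ hxI]
  linear_combination (-x : ℂ) * Complex.I_sq

theorem image_pi_sub_two_mul_arctan :
    (fun x => Real.pi - 2 * Real.arctan x) '' Set.univ = Set.Ioo 0 (2 * Real.pi) := by
  ext t
  simp only [Set.image_univ, Set.mem_range, Set.mem_Ioo]
  constructor
  · rintro ⟨x, rfl⟩
    constructor <;> linarith [Real.arctan_lt_pi_div_two x, Real.neg_pi_div_two_lt_arctan x]
  · rintro ⟨h0, h1⟩
    refine ⟨Real.tan ((Real.pi - t) / 2), ?_⟩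
    rw [Real.arctan_tan (by linarith) (by linarith)]
    ring

/-- The substitution θ = π - 2 arctan x turns dθ into 2 dx / (1 + x²); the one missed boundary
point, w = 1, is null. -/
theorem circleAverage_lowerCayley (u : ℂ → ℝ) (a : ℝ) :
    Real.circleAverage (fun w => u (lowerCayley a w)) 0 1 =
      Real.pi⁻¹ * ∫ x : ℝ, u x / (1 + (x - a) ^ 2) := by
  have hinj : Set.InjOn (fun x => Real.pi - 2 * Real.arctan x) Set.univ := fun x _ y _ h =>
    Real.arctan_injective (by simpa using h)
  have hder : ∀ x ∈ Set.univ, HasDerivWithinAt (fun x => Real.pi - 2 * Real.arctan x)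
      (-(2 * (1 / (1 + x ^ 2)))) Set.univ x := fun x _ =>
    (((Real.hasDerivAt_arctan x).const_mul 2).const_sub Real.pi).hasDerivWithinAt
  have key := integral_image_eq_integral_abs_deriv_smul MeasurableSet.univ hder hinj
    (fun θ => u (lowerCayley a (circleMap 0 1 θ)))
  rw [image_pi_sub_two_mul_arctan] at key
  rw [Real.circleAverage, intervalIntegral.integral_of_le Real.two_pi_pos.le,
    integral_Ioc_eq_integral_Ioo, key, setIntegral_univ,
    ← integral_add_right_eq_self (fun x : ℝ => u x / (1 + (x - a) ^ 2)) a, smul_eq_mul,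
    mul_inv, mul_assoc, mul_comm _ (Real.pi⁻¹ * _), mul_assoc, ← integral_mul_const]
  congr 2 with x
  have h0 : (0 : ℝ) < 1 + x ^ 2 := by positivity
  rw [circleMap_zero, Complex.ofReal_one, one_mul, lowerCayley_exp, abs_neg,
    abs_of_pos (by positivity), smul_eq_mul, add_sub_cancel_right, add_comm (a : ℂ)]
  push_cast
  field_simp

/-- The truncated logarithm is bounded and continuous up to the real line, so Jensen on circles of
radius r < 1 passes to r = 1 by dominated convergence. The bound `M` serves only as part of the
dominating constant. -/
theorem pi_mul_log_norm_le_integral {h : ℂ → ℂ} {M a ε : ℝ} (hε : 0 < ε)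
    (hd : DifferentiableOn ℂ h {z | z.im < 0}) (hc : ContinuousOn h {z | z.im ≤ 0})
    (hM : ∀ z : ℂ, z.im ≤ 0 → ‖h z‖ ≤ M) (h0 : h (a - Complex.I) ≠ 0) :
    Real.pi * Real.log ‖h (a - Complex.I)‖ ≤
      ∫ x : ℝ, Real.log (max ‖h x‖ ε) / (1 + (x - a) ^ 2) := by
  set u : ℂ → ℝ := fun z => Real.log (max ‖h z‖ ε) with hu
  have hcenter : lowerCayley a 0 = a - Complex.I := by simp [lowerCayley]
  have hopen : IsOpen {z : ℂ | z.im < 0} := isOpen_lt Complex.continuous_im continuous_const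
  have him : ∀ {w : ℂ}, ‖w‖ < 1 → (lowerCayley a w).im < 0 := fun {w} hw => by
    have hw1 : w ≠ 1 := fun h => by simp [h] at hw
    have : 0 < ‖1 - w‖ := norm_pos_iff.2 (sub_ne_zero.2 hw1.symm)
    rw [lowerCayley_im, neg_lt_zero]
    have : 0 < 1 - ‖w‖ ^ 2 := by nlinarith [norm_nonneg w]
    positivity
  have hcu : ContinuousOn u {z | z.im ≤ 0} :=
    ContinuousOn.log (hc.norm.sup continuousOn_const)
      fun z _ => (lt_of_lt_of_le hε (le_max_right _ _)).ne'
  have hub : ∀ z : ℂ, z.im ≤ 0 → ‖u z‖ ≤ |Real.log ε| + |Real.log (max M ε)| := fun z hz => by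
    have h1 : Real.log ε ≤ u z := Real.log_le_log hε (le_max_right _ _)
    have h2 : u z ≤ Real.log (max M ε) :=
      Real.log_le_log (lt_of_lt_of_le hε (le_max_right _ _)) (max_le_max_right _ (hM z hz))
    rw [Real.norm_eq_abs, abs_le]
    constructor
    · linarith [neg_abs_le (Real.log ε), abs_nonneg (Real.log (max M ε))]
    · linarith [le_abs_self (Real.log (max M ε)), abs_nonneg (Real.log ε)]
  have hle : ∀ r : ℝ, 0 < r → r < 1 →
      Real.log ‖h (a - Complex.I)‖ ≤ Real.circleAverage (fun w => u (lowerCayley a w)) 0 r := by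
    intro r hr0 hr1
    rw [← hcenter]
    refine log_norm_le_circleAverage_log_max (f := fun w => h (lowerCayley a w)) hr0.ne' hε ?_
      (by rwa [hcenter])
    have hball : DifferentiableOn ℂ (fun w => h (lowerCayley a w)) (Metric.ball 0 1) := by
      intro w hw
      rw [mem_ball_zero_iff] at hw
      have hw1 : w ≠ 1 := fun h => by simp [h] at hw
      exact (((hd _ (him hw)).differentiableAt (hopen.mem_nhds (him hw))).comp w
        (differentiableAt_lowerCayley a hw1)).differentiableWithinAt
    refine (hball.analyticOnNhd Metric.isOpen_ball).mono ?_
    exact Metric.closedBall_subset_ball (by rwa [abs_of_pos hr0])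
  have hlim : Tendsto (fun r : ℝ => Real.circleAverage (fun w => u (lowerCayley a w)) 0 r)
      (nhdsWithin 1 (Set.Ioo 0 1))
      (nhds (Real.circleAverage (fun w => u (lowerCayley a w)) 0 1)) := by
    have hcirc : ∀ (r θ : ℝ), 0 < r → ‖circleMap 0 r θ‖ = r := fun r θ hr => by
      rw [norm_circleMap_zero, abs_of_pos hr]
    refine Tendsto.const_smul ?_ _
    refine intervalIntegral.tendsto_integral_filter_of_dominated_convergence
      (fun _ => |Real.log ε| + |Real.log (max M ε)|) ?_ ?_ (by simp) ?_
    · filter_upwards [self_mem_nhdsWithin] with r hr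
      refine Continuous.aestronglyMeasurable (continuous_iff_continuousAt.2 fun θ => ?_)
      have hn : ‖circleMap 0 r θ‖ < 1 := by rw [hcirc r θ hr.1]; exact hr.2
      have hn1 : circleMap 0 r θ ≠ 1 := fun h => by simp [h] at hn
      have h1 : ContinuousAt u (lowerCayley a (circleMap 0 r θ)) :=
        hcu.continuousAt (mem_of_superset (hopen.mem_nhds (him hn)) fun z (hz : z.im < 0) => hz.le)
      exact ContinuousAt.comp (f := fun θ => lowerCayley a (circleMap 0 r θ)) h1 <|
        ContinuousAt.comp (f := circleMap 0 r) (continuousAt_lowerCayley a hn1)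
          (continuous_circleMap 0 r).continuousAt
    · filter_upwards [self_mem_nhdsWithin] with r hr
      refine Eventually.of_forall fun θ _ => hub _ (him ?_).le
      rw [hcirc r θ hr.1]; exact hr.2
    -- On (0, 2π] only θ = 2π hits the pole w = 1 of the Cayley map.
    · have hae : ∀ᵐ θ : ℝ, θ ≠ 2 * Real.pi := Measure.ae_ne volume _
      filter_upwards [hae] with θ hθ hθI
      rw [Set.uIoc_of_le Real.two_pi_pos.le] at hθI
      have hne : circleMap 0 1 θ ≠ 1 := by
        intro hone
        have hcos : Real.cos θ = 1 := by simpa [circleMap_zero, Complex.exp_mul_I,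
          ← Complex.ofReal_cos, ← Complex.ofReal_sin] using congrArg Complex.re hone
        have := (Real.cos_eq_one_iff_of_lt_of_lt (x := θ - 2 * Real.pi) (by linarith [hθI.1, Real.pi_pos]) 
          (by linarith [hθI.2, Real.pi_pos])).1 (by rwa [Real.cos_sub_two_pi])
        exact hθ (by linarith)
      have himb : (lowerCayley a (circleMap 0 1 θ)).im ≤ 0 := by
        rw [lowerCayley_im, hcirc 1 θ one_pos]; simp
      refine (hcu _ himb).tendsto.comp (tendsto_nhdsWithin_iff.2 ⟨?_, ?_⟩)
      · refine (continuousAt_lowerCayley a hne).tendsto.comp ?_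
        have : Continuous fun r : ℝ => circleMap 0 r θ := by unfold circleMap; fun_prop
        exact (this.tendsto 1).mono_left nhdsWithin_le_nhds
      · filter_upwards [self_mem_nhdsWithin] with r hr
        exact (him (by rw [hcirc r θ hr.1]; exact hr.2)).le
  have : (nhdsWithin (1 : ℝ) (Set.Ioo 0 1)).NeBot := right_nhdsWithin_Ioo_neBot one_pos
  have hfin := ge_of_tendsto hlim (by
    filter_upwards [self_mem_nhdsWithin] with r hr using hle r hr.1 hr.2)
  rw [circleAverage_lowerCayley, ← div_eq_inv_mul, le_div_iff₀ Real.pi_pos] at hfin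
  rwa [mul_comm]

/-! ### The Fatou limit. -/

/-- Positivity needs its own conclusion, since `posLog 0⁻¹ = 0` hides zeros of φ. The truncation
exposes them: where φ vanishes the approximating integrands tend to ∞, which the Fatou bound allows
only on a null set. -/
theorem ae_pos_and_lintegral_posLog_inv_lt_top {ψ : ℕ → ℝ → ℝ} {φ w : ℝ → ℝ} {ε : ℕ → ℝ} {K : ℝ}
    (hψ : ∀ n, Measurable (ψ n)) (hlim : ∀ᵐ x, Tendsto (fun n => ψ n x) atTop (nhds (φ x)))
    (hφ : ∀ᵐ x, 0 ≤ φ x) (hε : ∀ n, 0 < ε n) (hε0 : Tendsto ε atTop (nhds 0))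
    (hw : Continuous w) (hwpos : ∀ x, 0 < w x)
    (hK : ∀ᶠ n in atTop,
      ∫⁻ x, ENNReal.ofReal (Real.posLog (max (ψ n x) (ε n))⁻¹ * w x) ≤ ENNReal.ofReal K) :
    (∀ᵐ x, 0 < φ x) ∧ ∫⁻ x, ENNReal.ofReal (Real.posLog (φ x)⁻¹ * w x) < ⊤ := by
  have hmeas : ∀ n, Measurable
      (fun x => ENNReal.ofReal (Real.posLog (max (ψ n x) (ε n))⁻¹ * w x)) := fun n =>
    ((Real.continuous_posLog.measurable.comp
      ((hψ n).max measurable_const).inv).mul hw.measurable).ennreal_ofReal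
  have hfat : ∫⁻ x, liminf (fun n =>
      ENNReal.ofReal (Real.posLog (max (ψ n x) (ε n))⁻¹ * w x)) atTop ≤ ENNReal.ofReal K := by
    refine (lintegral_liminf_le hmeas).trans ?_
    exact liminf_le_of_frequently_le' hK.frequently
  have hfin := ae_lt_top (Measurable.liminf hmeas) (hfat.trans_lt ENNReal.ofReal_lt_top).ne
  have hmax : ∀ᵐ x, Tendsto (fun n => max (ψ n x) (ε n)) atTop (nhds (φ x)) := by
    filter_upwards [hlim, hφ] with x hx h0
    simpa [max_eq_left h0] using hx.max hε0
  have hpos : ∀ᵐ x, 0 < φ x := by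
    filter_upwards [hmax, hφ, hfin] with x hx h0 hf
    refine lt_of_le_of_ne h0 fun h => hf.ne ?_
    rw [← h] at hx
    refine Tendsto.liminf_eq (ENNReal.tendsto_ofReal_nhds_top.2 ?_)
    refine Tendsto.atTop_mul_const (hwpos x) ?_
    refine tendsto_atTop_mono (fun n => le_max_right _ _) (Real.tendsto_log_atTop.comp ?_)
    refine tendsto_inv_nhdsGT_zero.comp (tendsto_nhdsWithin_iff.2 ⟨hx, ?_⟩)
    exact Eventually.of_forall fun n => lt_of_lt_of_le (hε n) (le_max_right _ _)
  refine ⟨hpos, lt_of_le_of_lt (le_of_eq (lintegral_congr_ae ?_))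
    (hfat.trans_lt ENNReal.ofReal_lt_top)⟩
  filter_upwards [hmax, hpos] with x hx h0
  refine (Tendsto.liminf_eq ?_).symm
  exact (ENNReal.continuous_ofReal.tendsto _).comp <| Tendsto.mul_const _ <|
    (Real.continuous_posLog.tendsto _).comp (hx.inv₀ h0.ne')

/-! ### The Fourier–Laplace transform and its L² bounds. -/

/-- The Fourier–Laplace transform of `F`, normalised at `y₀`. -/
noncomputable def lowerTransform (F : ℝ → ℂ) (y₀ : ℝ) (z : ℂ) : ℂ :=
  ∫ y : ℝ, Complex.exp (-2 * Real.pi * Complex.I * z * (y - y₀)) * F y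

/-- `F` multiplied by an exponentially decaying factor that equals `1` at `y₀`. -/
noncomputable def expDamp (F : ℝ → ℂ) (y₀ δ : ℝ) (y : ℝ) : ℂ :=
  (Real.exp (-2 * Real.pi * δ * (y - y₀)) : ℝ) * F y

theorem norm_expDamp (F : ℝ → ℂ) (y₀ δ y : ℝ) :
    ‖expDamp F y₀ δ y‖ = Real.exp (-2 * Real.pi * δ * (y - y₀)) * ‖F y‖ := by
  rw [expDamp, norm_mul, Complex.norm_real, Real.norm_eq_abs, Real.abs_exp]

theorem norm_expDamp_ae_le {F : ℝ → ℂ} {y₀ δ : ℝ} (hδ : 0 ≤ δ)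
    (hsupp : ∀ᵐ y : ℝ, y < y₀ → F y = 0) : ∀ᵐ y : ℝ, ‖expDamp F y₀ δ y‖ ≤ ‖F y‖ := by
  filter_upwards [hsupp] with y hy
  rw [norm_expDamp]
  rcases lt_or_ge y y₀ with h | h
  · simp [hy h]
  · refine mul_le_of_le_one_left (norm_nonneg _) (Real.exp_le_one_iff.2 ?_)
    have : 0 ≤ 2 * Real.pi * δ * (y - y₀) :=
      mul_nonneg (mul_nonneg Real.two_pi_pos.le hδ) (sub_nonneg.2 h)
    linarith

theorem aestronglyMeasurable_expDamp {F : ℝ → ℂ} (hF : AEStronglyMeasurable F) (y₀ δ : ℝ) :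
    AEStronglyMeasurable (expDamp F y₀ δ) := by
  refine AEStronglyMeasurable.mul (Continuous.aestronglyMeasurable ?_) hF
  fun_prop

theorem memLp_expDamp {F : ℝ → ℂ} {y₀ δ : ℝ} (hF : MemLp F 2) (hδ : 0 ≤ δ)
    (hsupp : ∀ᵐ y : ℝ, y < y₀ → F y = 0) : MemLp (expDamp F y₀ δ) 2 :=
  hF.of_le (aestronglyMeasurable_expDamp hF.1 y₀ δ) (norm_expDamp_ae_le hδ hsupp)

/-- A product of two L² functions: `F` and the exponential cut off to [y₀, ∞). -/
theorem integrable_expDamp {F : ℝ → ℂ} {y₀ δ : ℝ} (hF : MemLp F 2) (hδ : 0 < δ)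
    (hsupp : ∀ᵐ y : ℝ, y < y₀ → F y = 0) : Integrable (expDamp F y₀ δ) := by
  set e : ℝ → ℂ := (Set.Ici y₀).indicator
    fun y => ((Real.exp (-2 * Real.pi * δ * (y - y₀)) : ℝ) : ℂ) with he
  have hcont : Continuous fun y : ℝ => ((Real.exp (-2 * Real.pi * δ * (y - y₀)) : ℝ) : ℂ) := by
    fun_prop
  have hmeas : AEStronglyMeasurable e :=
    hcont.aestronglyMeasurable.indicator measurableSet_Ici
  have he2 : MemLp e 2 := by
    rw [memLp_two_iff_integrable_sq_norm hmeas]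
    have h1 : IntegrableOn (fun y => Real.exp (4 * Real.pi * δ * y₀) *
        Real.exp (-(4 * Real.pi * δ) * y)) (Set.Ici y₀) := by
      rw [integrableOn_Ici_iff_integrableOn_Ioi]
      exact (exp_neg_integrableOn_Ioi y₀ (by positivity)).const_mul _
    refine (h1.integrable_indicator measurableSet_Ici).congr (Eventually.of_forall fun y => ?_)
    by_cases hy : y ∈ Set.Ici y₀
    · simp only [he, Set.indicator_of_mem hy, Complex.norm_real, Real.norm_eq_abs, Real.abs_exp]
      rw [← Real.exp_add, ← Real.exp_nat_mul]
      congr 1; push_cast; ring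
    · simp [he, Set.indicator_of_notMem hy]
  refine (he2.integrable_mul hF).congr ?_
  filter_upwards [hsupp] with y hy
  by_cases h : y₀ ≤ y
  · simp [he, expDamp, h]
  · simp [he, expDamp, h, hy (not_le.1 h)]

theorem lowerTransform_expDamp (F : ℝ → ℂ) (y₀ δ : ℝ) (z : ℂ) :
    lowerTransform (expDamp F y₀ δ) y₀ z = lowerTransform F y₀ (z - δ * Complex.I) := by
  unfold lowerTransform expDamp
  congr 1 with y
  rw [Complex.ofReal_exp, ← mul_assoc, ← Complex.exp_add]
  congr 2
  push_cast
  linear_combination (-2 * Real.pi * δ * (y - y₀) : ℂ) * Complex.I_sq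

theorem norm_lowerTransform_le {F : ℝ → ℂ} {y₀ : ℝ} (hF : Integrable F)
    (hsupp : ∀ᵐ y : ℝ, y < y₀ → F y = 0) {z : ℂ} (hz : z.im ≤ 0) :
    ‖lowerTransform F y₀ z‖ ≤ ∫ y, ‖F y‖ := by
  refine norm_integral_le_of_norm_le hF.norm ?_
  filter_upwards [hsupp] with y hy
  rcases lt_or_ge y y₀ with h | h
  · simp [hy h]
  · rw [norm_mul, Complex.norm_exp]
    refine mul_le_of_le_one_left (norm_nonneg _) (Real.exp_le_one_iff.2 ?_)
    have : (-2 * Real.pi * Complex.I * z * (y - y₀) : ℂ).re = 2 * Real.pi * z.im * (y - y₀) := by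
      simp
    rw [this]
    exact mul_nonpos_of_nonpos_of_nonneg
      (mul_nonpos_of_nonneg_of_nonpos Real.two_pi_pos.le hz) (sub_nonneg.2 h)

theorem norm_lowerTransform_ofReal (F : ℝ → ℂ) (y₀ x : ℝ) :
    ‖lowerTransform F y₀ x‖ = ‖𝓕 F x‖ := by
  have : lowerTransform F y₀ x =
      Complex.exp ((2 * Real.pi * x * y₀ : ℝ) * Complex.I) * 𝓕 F x := by
    rw [Real.fourier_real_eq_integral_exp_smul, ← integral_const_mul, lowerTransform]
    congr 1 with y
    rw [smul_eq_mul, ← mul_assoc, ← Complex.exp_add]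
    congr 2
    push_cast
    ring
  rw [this, norm_mul, Complex.norm_exp_ofReal_mul_I, one_mul]

theorem differentiableOn_lowerTransform {F : ℝ → ℂ} {y₀ : ℝ} (hF : MemLp F 2)
    (hsupp : ∀ᵐ y : ℝ, y < y₀ → F y = 0) :
    DifferentiableOn ℂ (lowerTransform F y₀) {z | z.im < 0} := by
  intro z₀ hz₀
  have hz₀' : z₀.im < 0 := hz₀
  -- Near `z₀`, at depth over c, the exponential splits into two factors exp(-πc(y - y₀)): one is
  -- the integrable damping at c/2, the other absorbs the factor 2π(y - y₀) from differentiation, at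
  -- cost 2/c, by t e⁻ᵗ ≤ 1.
  obtain ⟨c, hc, hcz⟩ : ∃ c : ℝ, 0 < c ∧ z₀.im = -(2 * c) := ⟨-z₀.im / 2, by linarith, by ring⟩
  set k : ℂ → ℝ → ℂ := fun z y => -2 * Real.pi * Complex.I * z * (y - y₀)
  have hkre : ∀ z y, (k z y).re = 2 * Real.pi * z.im * (y - y₀) := fun z y => by simp [k]
  have hopen : IsOpen {z : ℂ | z.im < -c} := isOpen_lt Complex.continuous_im continuous_const
  have hmeas : ∀ z, AEStronglyMeasurable (fun y => Complex.exp (k z y) * F y) := fun z =>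
    AEStronglyMeasurable.mul (Continuous.aestronglyMeasurable (by fun_prop)) hF.1
  refine (hasDerivAt_integral_of_dominated_loc_of_deriv_le (μ := volume)
    (F := fun z y => Complex.exp (k z y) * F y) (s := {z : ℂ | z.im < -c})
    (F' := fun z y => Complex.exp (k z y) * (-2 * Real.pi * Complex.I * (y - y₀)) * F y)
    (bound := fun y => 2 / c * ‖expDamp F y₀ (c / 2) y‖)
    (hopen.mem_nhds (show z₀.im < -c by linarith)) (Eventually.of_forall hmeas) ?_ ?_ ?_ ?_
    ?_).2.differentiableAt.differentiableWithinAt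
  · refine (integrable_expDamp hF hc hsupp).mono (hmeas _) ?_
    filter_upwards [hsupp] with y hy
    rcases lt_or_ge y y₀ with h | h
    · simp [hy h]
    · rw [norm_expDamp, norm_mul, Complex.norm_exp, hkre]
      refine mul_le_mul_of_nonneg_right (Real.exp_le_exp.2 ?_) (norm_nonneg _)
      rw [hcz]
      nlinarith [mul_nonneg (mul_nonneg Real.two_pi_pos.le hc.le) (sub_nonneg.2 h)]
  · exact AEStronglyMeasurable.mul (Continuous.aestronglyMeasurable (by fun_prop)) hF.1
  · filter_upwards [hsupp] with y hy z hz
    have hz' : z.im < -c := hz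
    rcases lt_or_ge y y₀ with h | h
    · simp [hy h, norm_expDamp]
    · have ht : 0 ≤ y - y₀ := sub_nonneg.2 h
      rw [norm_expDamp, norm_mul, norm_mul, Complex.norm_exp, hkre, ← mul_assoc]
      refine mul_le_mul_of_nonneg_right ?_ (norm_nonneg _)
      have hn : ‖(-2 * Real.pi * Complex.I * (y - y₀) : ℂ)‖ = 2 * Real.pi * (y - y₀) := by
        rw [← Complex.ofReal_sub, norm_mul, Complex.norm_real, Real.norm_of_nonneg ht]
        simp [abs_of_pos Real.pi_pos]
      rw [hn]
      set s := Real.pi * (y - y₀) with hs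
      have hs0 : 0 ≤ s := mul_nonneg Real.pi_pos.le ht
      have e1 : Real.exp (2 * Real.pi * z.im * (y - y₀)) ≤
          Real.exp (-2 * Real.pi * (c / 2) * (y - y₀)) * Real.exp (-(c * s)) := by
        rw [← Real.exp_add, Real.exp_le_exp]
        nlinarith
      have e2 : Real.exp (-(c * s)) * (c * s) ≤ 1 := by
        rw [Real.exp_neg, inv_mul_le_iff₀ (Real.exp_pos _), mul_one]
        linarith [Real.add_one_le_exp (c * s)]
      calc _ ≤ Real.exp (-2 * Real.pi * (c / 2) * (y - y₀)) * Real.exp (-(c * s)) * (2 * s) := by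
            rw [show 2 * Real.pi * (y - y₀) = 2 * s by rw [hs]; ring]
            gcongr
        _ = 2 / c * (Real.exp (-(c * s)) * (c * s)) *
              Real.exp (-2 * Real.pi * (c / 2) * (y - y₀)) := by field_simp
        _ ≤ 2 / c * 1 * Real.exp (-2 * Real.pi * (c / 2) * (y - y₀)) := by gcongr
        _ = _ := by ring
  · exact (integrable_expDamp hF (by positivity) hsupp).norm.const_mul _
  · refine Eventually.of_forall fun y z _ => ?_
    have h1 : HasDerivAt (fun z => k z y) (-2 * Real.pi * Complex.I * (y - y₀)) z := by
      simpa [k] using ((hasDerivAt_id z).const_mul (-2 * Real.pi * Complex.I : ℂ)).mul_const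
        ((y : ℂ) - y₀)
    exact h1.cexp.mul_const _

theorem tendsto_toLp_expDamp {F : ℝ → ℂ} {y₀ : ℝ} (hF : MemLp F 2)
    (hsupp : ∀ᵐ y : ℝ, y < y₀ → F y = 0) {δ : ℕ → ℝ} (hδ : ∀ n, 0 ≤ δ n)
    (hδ0 : Tendsto δ atTop (nhds 0)) :
    Tendsto (fun n => (memLp_expDamp hF (hδ n) hsupp).toLp (expDamp F y₀ (δ n))) atTop
      (nhds (hF.toLp F)) := by
  rw [Lp.tendsto_Lp_iff_tendsto_eLpNorm'']
  have h2 : (2 : ENNReal) ≠ 0 := two_ne_zero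
  simp only [eLpNorm_eq_lintegral_rpow_enorm_toReal h2 ENNReal.ofNat_ne_top]
  have hsq : Integrable fun y => (2 * ‖F y‖) ^ 2 := by
    simpa only [mul_pow] using ((memLp_two_iff_integrable_sq_norm hF.1).1 hF).const_mul (2 ^ 2)
  have hlim : Tendsto (fun n => ∫⁻ y, ‖(expDamp F y₀ (δ n) - F) y‖ₑ ^ (2 : ENNReal).toReal)
      atTop (nhds (∫⁻ _ : ℝ, 0)) := by
    refine tendsto_lintegral_of_dominated_convergence' (fun y => ENNReal.ofReal ((2 * ‖F y‖) ^ 2))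
      (fun n => ?_) (fun n => ?_) hsq.lintegral_lt_top.ne ?_
    · exact ((aestronglyMeasurable_expDamp hF.1 y₀ (δ n)).sub hF.1).enorm.pow_const _
    · filter_upwards [norm_expDamp_ae_le (hδ n) hsupp] with y hy
      rw [← ofReal_norm, ENNReal.toReal_ofNat, ENNReal.rpow_ofNat,
        ← ENNReal.ofReal_pow (norm_nonneg _)]
      refine ENNReal.ofReal_le_ofReal (pow_le_pow_left₀ (norm_nonneg _) ?_ 2)
      calc _ ≤ ‖expDamp F y₀ (δ n) y‖ + ‖F y‖ := norm_sub_le _ _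
        _ ≤ _ := by linarith
    · refine Eventually.of_forall fun y => ?_
      have h1 : Tendsto (fun n => (expDamp F y₀ (δ n) - F) y) atTop (nhds 0) := by
        have hc : Continuous fun d : ℝ => expDamp F y₀ d y - F y := by unfold expDamp; fun_prop
        simpa [expDamp, Function.comp_def] using (hc.tendsto 0).comp hδ0
      have := (ENNReal.continuous_rpow_const (y := (2 : ENNReal).toReal)).tendsto 0 |>.comp
        (by simpa using h1.enorm)
      simpa [Function.comp_def] using this
  have := (ENNReal.continuous_rpow_const (y := 1 / (2 : ENNReal).toReal)).tendsto _ |>.comp hlim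
  simpa [Function.comp_def] using this

theorem integral_norm_sq_eq_norm_sq (f : Lp ℂ 2 (volume : Measure ℝ)) :
    ∫ x, ‖f x‖ ^ 2 = ‖f‖ ^ 2 := by
  have h := L2.inner_def (𝕜 := ℂ) f f
  simp only [inner_self_eq_norm_sq_to_K] at h
  have h2 : ((‖f‖ ^ 2 : ℝ) : ℂ) = ((∫ x, ‖f x‖ ^ 2 : ℝ) : ℂ) := by
    rw [← integral_complex_ofReal]
    simpa using h
  exact_mod_cast h2.symm

theorem norm_fourier_toLp_expDamp_ae_eq {F : ℝ → ℂ} {y₀ δ : ℝ} (hF : MemLp F 2)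
    (hsupp : ∀ᵐ y : ℝ, y < y₀ → F y = 0) (hδ : 0 < δ) :
    (fun x => ‖(𝓕 ((memLp_expDamp hF hδ.le hsupp).toLp (expDamp F y₀ δ)) :
      Lp ℂ 2 (volume : Measure ℝ)) x‖) =ᵐ[volume]
      fun x : ℝ => ‖lowerTransform F y₀ (x - δ * Complex.I)‖ := by
  filter_upwards [fourier_toLp_ae_eq (integrable_expDamp hF hδ hsupp)
    (memLp_expDamp hF hδ.le hsupp)] with x hx
  rw [hx, ← norm_lowerTransform_ofReal, lowerTransform_expDamp]

theorem integrable_norm_lowerTransform_sq {F : ℝ → ℂ} {y₀ δ : ℝ} (hF : MemLp F 2)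
    (hsupp : ∀ᵐ y : ℝ, y < y₀ → F y = 0) (hδ : 0 < δ) :
    Integrable (fun x : ℝ => ‖lowerTransform F y₀ (x - δ * Complex.I)‖ ^ 2) ∧
      ∫ x : ℝ, ‖lowerTransform F y₀ (x - δ * Complex.I)‖ ^ 2 ≤ ‖hF.toLp F‖ ^ 2 := by
  set f := (memLp_expDamp hF hδ.le hsupp).toLp (expDamp F y₀ δ) with hf
  have hsq : (fun x => ‖(𝓕 f : Lp ℂ 2 (volume : Measure ℝ)) x‖ ^ 2) =ᵐ[volume]
      fun x : ℝ => ‖lowerTransform F y₀ (x - δ * Complex.I)‖ ^ 2 := by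
    filter_upwards [norm_fourier_toLp_expDamp_ae_eq hF hsupp hδ] with x hx
    rw [← hx]
  refine ⟨((memLp_two_iff_integrable_sq_norm (Lp.memLp _).1).1 (Lp.memLp (𝓕 f))).congr hsq, ?_⟩
  rw [← integral_congr_ae hsq, integral_norm_sq_eq_norm_sq, Lp.norm_fourier_eq]
  refine pow_le_pow_left₀ (norm_nonneg _) (Lp.norm_le_norm_of_ae_le ?_) 2
  filter_upwards [norm_expDamp_ae_le hδ.le hsupp, hF.coeFn_toLp,
    (memLp_expDamp hF hδ.le hsupp).coeFn_toLp] with x h1 h2 h3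
  rwa [h2, hf, h3]

/-- Supplies a centre for Jensen: vanishing on a whole horizontal line would force F = 0 by
Plancherel, as the damping factor is never zero. -/
theorem exists_lowerTransform_ne_zero {F : ℝ → ℂ} {y₀ δ : ℝ} (hF : MemLp F 2)
    (hsupp : ∀ᵐ y : ℝ, y < y₀ → F y = 0) (hF0 : ¬ F =ᵐ[volume] 0) (hδ : 0 < δ) :
    ∃ a : ℝ, lowerTransform F y₀ (a - δ * Complex.I) ≠ 0 := by
  by_contra! h
  set f := (memLp_expDamp hF hδ.le hsupp).toLp (expDamp F y₀ δ) with hf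
  have h1 : (𝓕 f : Lp ℂ 2 (volume : Measure ℝ)) = 0 := by
    rw [Lp.eq_zero_iff_ae_eq_zero]
    filter_upwards [norm_fourier_toLp_expDamp_ae_eq hF hsupp hδ] with x hx
    rw [h, norm_zero] at hx
    exact norm_eq_zero.1 hx
  have h2 : f = 0 := by rw [← norm_eq_zero, ← Lp.norm_fourier_eq, h1, norm_zero]
  rw [Lp.eq_zero_iff_ae_eq_zero] at h2
  refine hF0 ?_
  filter_upwards [h2, (memLp_expDamp hF hδ.le hsupp).coeFn_toLp] with x hx hx2
  rw [hx2] at hx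
  exact (mul_eq_zero.1 hx).resolve_left (by exact_mod_cast (Real.exp_pos _).ne')

/-! ### Uniform logarithmic bounds and the passage to the boundary. -/

theorem integrable_inv_one_add_sub_sq (a : ℝ) : Integrable fun x : ℝ => (1 + (x - a) ^ 2)⁻¹ :=
  integrable_inv_one_add_sq.comp_sub_right a

theorem posLog_le_sq {t : ℝ} (ht : 0 ≤ t) : Real.posLog t ≤ t ^ 2 := by
  rcases ht.eq_or_lt with rfl | h
  · simp
  · exact max_le (sq_nonneg t) ((Real.log_le_sub_one_of_pos h).trans (by nlinarith [sq_nonneg (t - 1)]))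

theorem posLog_max_le_sq {t ε : ℝ} (ht : 0 ≤ t) (hε : 0 < ε) (hε1 : ε ≤ 1) :
    Real.posLog (max t ε) ≤ t ^ 2 := by
  rcases le_total ε t with h | h
  · rw [max_eq_left h]; exact posLog_le_sq ht
  · rw [max_eq_right h, Real.posLog_eq_zero_iff _ |>.2 (by rwa [abs_of_pos hε])]
    positivity

/-- Splitting log = log⁺ - log⁻ in Jensen's inequality leaves a bound free of ε, and dependent on δ
only through the value at the centre. -/
theorem lintegral_posLog_inv_lowerTransform_le {F : ℝ → ℂ} {y₀ δ ε a : ℝ} (hF : MemLp F 2)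
    (hsupp : ∀ᵐ y : ℝ, y < y₀ → F y = 0) (hδ : 0 < δ) (hε : 0 < ε) (hε1 : ε ≤ 1)
    (ha : lowerTransform F y₀ (a - Complex.I - δ * Complex.I) ≠ 0) :
    ∫⁻ x : ℝ, ENNReal.ofReal
      (Real.posLog (max ‖lowerTransform F y₀ (x - δ * Complex.I)‖ ε)⁻¹ * (1 + (x - a) ^ 2)⁻¹) ≤
      ENNReal.ofReal (‖hF.toLp F‖ ^ 2 -
        Real.pi * Real.log ‖lowerTransform F y₀ (a - Complex.I - δ * Complex.I)‖) := by
  set ψ : ℝ → ℝ := fun x => ‖lowerTransform F y₀ (x - δ * Complex.I)‖ with hψ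
  have hmaps : Set.MapsTo (fun z : ℂ => z - δ * Complex.I) {z | z.im ≤ 0} {z | z.im < 0} := by
    intro z (hz : z.im ≤ 0)
    simp only [Set.mem_ofPred_eq, Complex.sub_im, Complex.mul_im, Complex.ofReal_re, Complex.I_im,
      Complex.ofReal_im, Complex.I_re]
    linarith
  have hdiff : DifferentiableOn ℂ (fun z => lowerTransform F y₀ (z - δ * Complex.I))
      {z | z.im ≤ 0} :=
    (differentiableOn_lowerTransform hF hsupp).comp (by fun_prop) hmaps
  have hψc : Continuous ψ := by
    refine Continuous.norm (continuousOn_univ.1 ?_)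
    exact hdiff.continuousOn.comp (Complex.continuous_ofReal.continuousOn)
      fun x _ => show (x : ℂ).im ≤ 0 by simp
  have hsupp' : ∀ᵐ y : ℝ, y < y₀ → expDamp F y₀ δ y = 0 := by
    filter_upwards [hsupp] with y hy h
    simp [expDamp, hy h]
  have hjen := pi_mul_log_norm_le_integral (a := a) hε (hdiff.mono fun z (hz : z.im < 0) => hz.le)
    hdiff.continuousOn (M := ∫ y, ‖expDamp F y₀ δ y‖) (fun z hz => by
      rw [← lowerTransform_expDamp]
      exact norm_lowerTransform_le (integrable_expDamp hF hδ hsupp) hsupp' hz) ha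
  obtain ⟨hint, hle⟩ := integrable_norm_lowerTransform_sq hF hsupp hδ
  have hw : ∀ x : ℝ, 0 ≤ (1 + (x - a) ^ 2)⁻¹ := fun x => by positivity
  have hw1 : ∀ x : ℝ, (1 + (x - a) ^ 2)⁻¹ ≤ 1 := fun x =>
    inv_le_one_of_one_le₀ (by linarith [sq_nonneg (x - a)])
  have hwc : Continuous fun x : ℝ => (1 + (x - a) ^ 2)⁻¹ :=
    Continuous.inv₀ (by fun_prop) fun x => by positivity
  have hmaxpos : ∀ x, 0 < max (ψ x) ε := fun x => lt_of_lt_of_le hε (le_max_right _ _)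
  have hmaxc : Continuous fun x => max (ψ x) ε := hψc.max continuous_const
  have hplus : ∀ x, Real.posLog (max (ψ x) ε) * (1 + (x - a) ^ 2)⁻¹ ≤ ψ x ^ 2 := fun x =>
    (mul_le_of_le_one_right Real.posLog_nonneg (hw1 x)).trans
      (posLog_max_le_sq (norm_nonneg _) hε hε1)
  have hI1 : Integrable fun x => Real.posLog (max (ψ x) ε) * (1 + (x - a) ^ 2)⁻¹ := by
    refine hint.mono' ?_ (Eventually.of_forall fun x => ?_)
    · exact ((Real.continuous_posLog.comp hmaxc).mul hwc).aestronglyMeasurable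
    · rw [Real.norm_of_nonneg (mul_nonneg Real.posLog_nonneg (hw x))]
      exact hplus x
  have hI2 : Integrable fun x => Real.posLog (max (ψ x) ε)⁻¹ * (1 + (x - a) ^ 2)⁻¹ := by
    refine ((integrable_inv_one_add_sub_sq a).const_mul (Real.posLog ε⁻¹)).mono' ?_
      (Eventually.of_forall fun x => ?_)
    · exact ((Real.continuous_posLog.comp
        (hmaxc.inv₀ fun x => (hmaxpos x).ne')).mul hwc).aestronglyMeasurable
    · rw [Real.norm_of_nonneg (mul_nonneg Real.posLog_nonneg (hw x))]
      refine mul_le_mul_of_nonneg_right (Real.posLog_le_posLog (inv_pos.2 (hmaxpos x)).le ?_) (hw x)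
      exact inv_anti₀ hε (le_max_right _ _)
  rw [← ofReal_integral_eq_lintegral_ofReal hI2
    (Eventually.of_forall fun x => mul_nonneg Real.posLog_nonneg (hw x))]
  refine ENNReal.ofReal_le_ofReal ?_
  have hsplit : ∫ x : ℝ, Real.log (max (ψ x) ε) / (1 + (x - a) ^ 2) =
      (∫ x, Real.posLog (max (ψ x) ε) * (1 + (x - a) ^ 2)⁻¹) -
        ∫ x, Real.posLog (max (ψ x) ε)⁻¹ * (1 + (x - a) ^ 2)⁻¹ := by
    rw [← integral_sub hI1 hI2]
    congr 1 with x
    rw [← sub_mul, Real.posLog_sub_posLog_inv, div_eq_mul_inv]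
  have hmono := integral_mono hI1 hint hplus
  have hjen' := hjen.trans_eq hsplit
  linarith

theorem exists_ae_pos_and_lintegral_posLog_inv_lt_top {F : ℝ → ℂ} {y₀ : ℝ} (hF : MemLp F 2)
    (hsupp : ∀ᵐ y : ℝ, y < y₀ → F y = 0) (hF0 : ¬ F =ᵐ[volume] 0) :
    ∃ a : ℝ, (∀ᵐ x, 0 < ‖(𝓕 (hF.toLp F) : Lp ℂ 2 (volume : Measure ℝ)) x‖) ∧
      ∫⁻ x, ENNReal.ofReal (Real.posLog ‖(𝓕 (hF.toLp F) : Lp ℂ 2 (volume : Measure ℝ)) x‖⁻¹ *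
        (1 + (x - a) ^ 2)⁻¹) < ⊤ := by
  -- Depth 1 is where the Cayley map sends the centre of the disk.
  obtain ⟨a, ha⟩ := exists_lowerTransform_ne_zero hF hsupp hF0 one_pos
  rw [Complex.ofReal_one, one_mul] at ha
  refine ⟨a, ?_⟩
  set δ : ℕ → ℝ := fun n => 1 / ((n : ℝ) + 1) with hδdef
  have hδ : ∀ n, 0 < δ n := fun n => Nat.one_div_pos_of_nat
  have hδ1 : ∀ n, δ n ≤ 1 := fun n => by
    rw [hδdef, div_le_one (by positivity)]; linarith [n.cast_nonneg (α := ℝ)]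
  have hδ0 : Tendsto δ atTop (nhds 0) := tendsto_one_div_add_atTop_nhds_zero_nat
  have hopen : IsOpen {z : ℂ | z.im < 0} := isOpen_lt Complex.continuous_im continuous_const
  have hT := differentiableOn_lowerTransform hF hsupp
  have hTc : ∀ z : ℂ, z.im < 0 → ContinuousAt (lowerTransform F y₀) z := fun z hz =>
    (hT.differentiableAt (hopen.mem_nhds hz)).continuousAt
  have hFT : Tendsto (fun n => (𝓕 ((memLp_expDamp hF (hδ n).le hsupp).toLp
      (expDamp F y₀ (δ n))) : Lp ℂ 2 (volume : Measure ℝ))) atTop (nhds (𝓕 (hF.toLp F))) :=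
    ((Lp.fourierTransformₗᵢ ℝ ℂ).continuous.tendsto _).comp
      (tendsto_toLp_expDamp hF hsupp (fun n => (hδ n).le) hδ0)
  obtain ⟨ns, hns, hae⟩ := (tendstoInMeasure_of_tendsto_Lp hFT).exists_seq_tendsto_ae
  have hns' := hns.tendsto_atTop
  have hcont : ∀ d : ℝ, 0 < d →
      Continuous fun x : ℝ => ‖lowerTransform F y₀ (x - d * Complex.I)‖ := fun d hd =>
    continuous_iff_continuousAt.2 fun x => ContinuousAt.norm <|
      ContinuousAt.comp (f := fun x : ℝ => (x : ℂ) - d * Complex.I) (hTc _ (by simpa using hd))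
        (by fun_prop)
  have hpt : Tendsto (fun i => lowerTransform F y₀ (a - Complex.I - δ (ns i) * Complex.I)) atTop
      (nhds (lowerTransform F y₀ (a - Complex.I))) := by
    refine (hTc (a - Complex.I) (by simp)).tendsto.comp ?_
    have hc : Continuous fun d : ℝ => (a - Complex.I - d * Complex.I : ℂ) := by fun_prop
    simpa [Function.comp_def] using (hc.tendsto 0).comp (hδ0.comp hns')
  have hlog := hpt.norm.log (norm_ne_zero_iff.2 ha)
  -- The slack 1 gives one constant valid for all large `i`.
  have hev : ∀ᶠ i in atTop, Real.log ‖lowerTransform F y₀ (a - Complex.I)‖ - 1 <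
      Real.log ‖lowerTransform F y₀ (a - Complex.I - δ (ns i) * Complex.I)‖ :=
    hlog.eventually_const_lt (by linarith)
  refine ae_pos_and_lintegral_posLog_inv_lt_top
    (ψ := fun i x => ‖lowerTransform F y₀ (x - δ (ns i) * Complex.I)‖) (ε := fun i => δ (ns i))
    (K := ‖hF.toLp F‖ ^ 2 - Real.pi * (Real.log ‖lowerTransform F y₀ (a - Complex.I)‖ - 1))
    (w := fun x => (1 + (x - a) ^ 2)⁻¹)
    (fun i => (hcont _ (hδ _)).measurable) ?_ (Eventually.of_forall fun x => norm_nonneg _)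
    (fun i => hδ _) (hδ0.comp hns') (Continuous.inv₀ (by fun_prop) fun x => by positivity)
    (fun x => by positivity) ?_
  · have hall := ae_all_iff.2 fun i => norm_fourier_toLp_expDamp_ae_eq hF hsupp (hδ (ns i))
    filter_upwards [hae, hall] with x hx hall
    exact hx.norm.congr hall
  · filter_upwards [hev, hpt.eventually_ne ha] with i hi hne
    refine (lintegral_posLog_inv_lowerTransform_le hF hsupp (hδ _) (hδ _) (hδ1 _) hne).trans
      (ENNReal.ofReal_le_ofReal ?_)
    gcongr

/-! ### Integrability of log φ and limits on decay. -/

theorem abs_log_eq_posLog_add_posLog_inv (t : ℝ) :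
    |Real.log t| = Real.posLog t + Real.posLog t⁻¹ := by
  rw [Real.posLog, Real.posLog, Real.log_inv]
  rcases le_total 0 (Real.log t) with h | h
  · rw [abs_of_nonneg h, max_eq_right h, max_eq_left (by linarith), add_zero]
  · rw [abs_of_nonpos h, max_eq_left h, max_eq_right (by linarith), zero_add]

theorem integrable_abs_log_div {φ : ℝ → ℝ} {a : ℝ} (hφ : MemLp φ 2) (hpos : ∀ᵐ x, 0 < φ x)
    (hlog : ∫⁻ x, ENNReal.ofReal (Real.posLog (φ x)⁻¹ * (1 + (x - a) ^ 2)⁻¹) < ⊤) :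
    Integrable fun x : ℝ => |Real.log (φ x)| / (1 + x ^ 2) := by
  have hφm := hφ.1.aemeasurable
  have hwm : ∀ b : ℝ, Measurable fun x : ℝ => (1 + (x - b) ^ 2)⁻¹ := fun b => by fun_prop
  have hpm := Real.continuous_posLog.measurable
  have h1 : Integrable fun x => Real.posLog (φ x)⁻¹ * (1 + (x - a) ^ 2)⁻¹ := by
    refine ⟨((hpm.comp_aemeasurable hφm.inv).mul (hwm a).aemeasurable).aestronglyMeasurable, ?_⟩
    rw [hasFiniteIntegral_iff_ofReal (Eventually.of_forall fun x =>
      mul_nonneg Real.posLog_nonneg (by positivity))]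
    exact hlog
  have h2 : Integrable fun x => φ x ^ 2 := hφ.integrable_sq
  refine (h2.add (h1.const_mul (2 * (1 + a ^ 2)))).mono' ?_ ?_
  · have := ((Real.measurable_log.comp_aemeasurable hφm).norm).mul (hwm 0).aemeasurable
    simpa [div_eq_mul_inv, Pi.mul_def] using this.aestronglyMeasurable
  · filter_upwards [hpos] with x hx
    have hx0 : (0 : ℝ) < 1 + x ^ 2 := by positivity
    have hxa : (0 : ℝ) < 1 + (x - a) ^ 2 := by positivity
    rw [Real.norm_of_nonneg (by positivity), abs_log_eq_posLog_add_posLog_inv, add_div]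
    refine add_le_add ?_ ?_
    · exact (div_le_self Real.posLog_nonneg (by nlinarith)).trans (posLog_le_sq hx.le)
    · change Real.posLog (φ x)⁻¹ / (1 + x ^ 2) ≤
        2 * (1 + a ^ 2) * (Real.posLog (φ x)⁻¹ * (1 + (x - a) ^ 2)⁻¹)
      rw [div_eq_mul_inv, mul_left_comm]
      refine mul_le_mul_of_nonneg_left ?_ Real.posLog_nonneg
      rw [← div_eq_mul_inv, inv_eq_one_div, div_le_div_iff₀ hx0 hxa]
      -- Recentring the weight: 1 + (x - a)² ≤ 2(1 + a²)(1 + x²).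
      nlinarith [sq_nonneg (x + a), mul_nonneg (sq_nonneg x) (sq_nonneg a)]

theorem not_ae_le_exp_of_integrable_log {φ : ℝ → ℝ} (hpos : ∀ᵐ x, 0 < φ x)
    (hint : Integrable fun x : ℝ => |Real.log (φ x)| / (1 + x ^ 2)) {B : ℝ} (hB : 0 < B)
    (C X : ℝ) : ¬ ∀ᵐ x : ℝ, X ≤ x → φ x ≤ C * Real.exp (-B * |x|) := by
  intro h
  set D := max C 1
  have hD : 0 < D := lt_of_lt_of_le one_pos (le_max_right _ _)
  -- Beyond `Y`, log D ≤ Bx/2 and 1 + x² ≤ 2x²; this yields the factor 4/B.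
  set Y := max X (max 1 (2 * Real.log D / B))
  refine not_integrableOn_Ici_inv (a := Y) ?_
  refine (hint.const_mul (4 / B)).integrableOn.mono' measurable_inv.aestronglyMeasurable ?_
  filter_upwards [ae_restrict_of_ae h, ae_restrict_of_ae hpos, ae_restrict_mem measurableSet_Ici]
    with x hx h0 (hY : Y ≤ x)
  have hxX : X ≤ x := (le_max_left _ _).trans hY
  have hx1 : 1 ≤ x := ((le_max_left _ _).trans (le_max_right _ _)).trans hY
  have hxD : 2 * Real.log D / B ≤ x := ((le_max_right _ _).trans (le_max_right _ _)).trans hY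
  have hx0 : 0 < x := by linarith
  rw [div_le_iff₀ hB] at hxD
  have h1 : φ x ≤ D * Real.exp (-B * x) := by
    refine (hx hxX).trans ?_
    rw [abs_of_pos hx0]
    gcongr
    exact le_max_left _ _
  have h2 : Real.log (φ x) ≤ Real.log D - B * x := by
    refine (Real.log_le_log h0 h1).trans_eq ?_
    rw [Real.log_mul hD.ne' (Real.exp_pos _).ne', Real.log_exp]
    ring
  have h3 : B * x / 2 ≤ |Real.log (φ x)| := le_trans (by linarith) (neg_le_abs _)
  rw [Real.norm_of_nonneg (inv_pos.2 hx0).le]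
  calc x⁻¹ = 4 / B * (B * x / 2 / (2 * x ^ 2)) := by field_simp; norm_num
    _ ≤ 4 / B * (|Real.log (φ x)| / (1 + x ^ 2)) := by
      gcongr
      nlinarith

theorem DecaysAtLeastLike.exists_ae_le_atTop {φ : ℝ → ℝ} {B : ℝ}
    (h : DecaysAtLeastLike φ atTop B 1) :
    ∃ C X : ℝ, ∀ᵐ x : ℝ, X ≤ x → φ x ≤ C * Real.exp (-B * |x|) := by
  obtain ⟨C, hC⟩ := h
  obtain ⟨s, hs, t, ht, hst⟩ := mem_inf_iff_superset.1 hC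
  obtain ⟨X, hX⟩ := mem_atTop_sets.1 hs
  refine ⟨C, X, ?_⟩
  filter_upwards [ht] with x hx hXx
  have h1 : |φ x| ≤ C * Real.exp (-B * |x| ^ (1 : ℝ)) := hst ⟨hX x hXx, hx⟩
  rw [Real.rpow_one] at h1
  exact (le_abs_self _).trans h1

theorem DecaysAtLeastLike.comp_neg {φ : ℝ → ℝ} {B α : ℝ} (h : DecaysAtLeastLike φ atBot B α) :
    DecaysAtLeastLike (fun x => φ (-x)) atTop B α := by
  obtain ⟨C, hC⟩ := h
  refine ⟨C, ?_⟩
  have ht : Tendsto (fun x : ℝ => -x) (atTop ⊓ ae volume) (atBot ⊓ ae volume) :=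
    tendsto_neg_atTop_atBot.inf (Measure.measurePreserving_neg volume).quasiMeasurePreserving.tendsto_ae
  simpa using ht.eventually hC

/-- Reduces every α ≥ 1 to the exponential case, since |x| ≤ |x|^α once |x| ≥ 1. -/
theorem DecaysAtLeastLike.of_one_le {φ : ℝ → ℝ} {l : Filter ℝ} {B α : ℝ} (hB : 0 < B)
    (hl : ∀ᶠ x in l, 1 ≤ |x|) (hα : 1 ≤ α) (h : DecaysAtLeastLike φ l B α) :
    DecaysAtLeastLike φ l B 1 := by
  obtain ⟨C, hC⟩ := h
  refine ⟨max C 0, ?_⟩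
  filter_upwards [hC, hl.filter_mono inf_le_left] with x hx h1
  refine hx.trans ?_
  have h2 : |x| ^ (1 : ℝ) ≤ |x| ^ α := Real.rpow_le_rpow_of_exponent_le h1 hα
  calc C * Real.exp (-B * |x| ^ α) ≤ max C 0 * Real.exp (-B * |x| ^ α) := by
        gcongr; exact le_max_left _ _
    _ ≤ max C 0 * Real.exp (-B * |x| ^ (1 : ℝ)) := by
        refine mul_le_mul_of_nonneg_left (Real.exp_le_exp.2 ?_) (le_max_right _ _)
        nlinarith

theorem mainTheorem1 (F : ℝ → ℂ) (hF : MemLp F 2 (volume : Measure ℝ))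
    (hF0 : ¬ F =ᵐ[volume] 0)
    (y₀ : ℝ) (hsupp : ∀ᵐ y ∂(volume : Measure ℝ), y < y₀ → F y = 0)
    (φ : ℝ → ℝ)
    (hφ : φ =ᵐ[volume] fun x => ‖(𝓕 (hF.toLp F) : Lp ℂ 2 (volume : Measure ℝ)) x‖) :
    ((∀ᵐ x ∂(volume : Measure ℝ), 0 < φ x) ∧
      Integrable (fun x : ℝ => |Real.log (φ x)| / (1 + x ^ 2)) (volume : Measure ℝ)) ∧
    (∀ B : ℝ, 0 < B →
      ¬ DecaysAtLeastLike φ atTop B 1 ∧ ¬ DecaysAtLeastLike φ atBot B 1) ∧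
    (∀ B α : ℝ, 0 < B →
      (DecaysAtLeastLike φ atTop B α ∨ DecaysAtLeastLike φ atBot B α) → α < 1) := by
  obtain ⟨a, hpos', hlog⟩ := exists_ae_pos_and_lintegral_posLog_inv_lt_top hF hsupp hF0
  have hpos : ∀ᵐ x, 0 < φ x := by
    filter_upwards [hφ, hpos'] with x hx h0
    rwa [hx]
  have hint : Integrable (fun x : ℝ => |Real.log (φ x)| / (1 + x ^ 2)) := by
    refine (integrable_abs_log_div (Lp.memLp (𝓕 (hF.toLp F))).norm hpos' hlog).congr ?_
    filter_upwards [hφ] with x hx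
    rw [hx]
  have hexp : ∀ B : ℝ, 0 < B →
      ¬ DecaysAtLeastLike φ atTop B 1 ∧ ¬ DecaysAtLeastLike φ atBot B 1 := by
    refine fun B hB => ⟨fun h => ?_, fun h => ?_⟩
    · obtain ⟨C, X, hCX⟩ := h.exists_ae_le_atTop
      exact not_ae_le_exp_of_integrable_log hpos hint hB C X hCX
    · obtain ⟨C, X, hCX⟩ := h.comp_neg.exists_ae_le_atTop
      refine not_ae_le_exp_of_integrable_log (φ := fun x => φ (-x)) ?_ ?_ hB C X hCX
      · exact (Measure.measurePreserving_neg volume).quasiMeasurePreserving.tendsto_ae.eventually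
          hpos
      · simpa using hint.comp_neg
  refine ⟨⟨hpos, hint⟩, hexp, fun B α hB h => ?_⟩
  by_contra! hα
  rcases h with h | h
  · exact (hexp B hB).1 (h.of_one_le hB (tendsto_abs_atTop_atTop.eventually_ge_atTop 1) hα)
  · exact (hexp B hB).2 (h.of_one_le hB (tendsto_abs_atBot_atTop.eventually_ge_atTop 1) hα)
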